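/- Let $\Bbbk$ be a field of characteristic $p>0$, let $S=\Bbbk[x_1,\dots,x_n]$ with its standard grading, let $m\ge 1$, and let $\mathfrak p_1,\dots,\mathfrak p_m$ be nonzero homogeneous prime ideals of $S$. **Notation.** $\overline{I}$ denotes the integral closure of an ideal $I$. For a prime $\mathfrak p$ and $\ell\in\mathbb N$, $\mathfrak p^{(\ell)}=\mathfrak p^\ell S_{\mathfrak p}\cap S$ is the symbolic power; $\mathfrak p^{(\ell)}=S$ for integers $\ell\le 0$. For $\sigma\in\mathbb N^m$ put $I^\sigma=\mathfrak p_1^{\sigma_1}\cdots\mathfrak p_m^{\sigma_m}$ and $e_k(\sigma)=\max\{\ell\in\mathbb N: I^\sigma\subseteq\mathfrak p_k^{(\ell)}\}$. For $\Sigma\subseteq\mathbb N^m$ put $I(\Sigma)=\sum_{\sigma\in\Sigma}I^\sigma$, let $\overline\Sigma\subseteq\mathbb Q^m$ be the convex hull of $\Sigma$ in $\mathbb Q^m$, and let $P_\Sigma\subseteq\mathbb Q^m$ be the convex hull in $\mathbb Q^m$ of $\{(e_1(\sigma),\dots,e_m(\sigma)):\sigma\in\Sigma\}$. For $\mathbf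 v\in\mathbb Q^m$, $\lceil\mathbf v\rceil$ is the componentwise ceiling. For an ideal $J\subseteq S$ and $q=p^e$, $J^{[q]}$ is the ideal generated by the $q$-th powers of the elements of $J$, and $I^{[1/q]}$ is the smallest ideal $J$ with $I\subseteq J^{[q]}$. For a real $\lambda>0$, the generalized test ideal $\tau(\lambda\cdot I)$ is the common value of $\bigl(I^{\lceil\lambda p^e\rceil}\bigr)^{[1/p^e]}$ for all $e\gg0$. **Conditions.** - **A**: $\overline{I^\sigma}=\bigcap_{k=1}^m\mathfrak p_k^{(e_k(\sigma))}$ for all $\sigma\in\mathbb N^m$. - **A+**: $\overline{I(\Sigma)}=\sum_{\mathbf v\in\overline\Sigma}\ \bigcap_{k=1}^m\mathfrak p_k^{(e_k(\lceil\mathbf v\rceil))}$ for all $\Sigma\subseteq\mathbb N^m$. - **B**: there is a polynomial $f\in\bigcap_{k=1}^m\mathfrak p_k^{(\operatorname{ht}\mathfrak p_k)}$ whose initial monomial with respect to some term order on $S$ is square-free. (In particular this holds if such an $f$ lies in the smaller ideal $\bigcap_{k=1}^m\mathfrak p_k^{\operatorname{ht}\mathfrak p_k}$.) **Theorem.** If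 $\mathfrak p_1,\dots,\mathfrak p_m$ satisfy A and B, then for every real $\lambda>0$ and every $\sigma\in\mathbb N^m$ $$\tau(\lambda\cdot I^\sigma)=\bigcap_{k=1}^m\mathfrak p_k^{(\lfloor\lambda e_k(\sigma)\rfloor+1-\operatorname{ht}\mathfrak p_k)}.$$ If $\mathfrak p_1,\dots,\mathfrak p_m$ satisfy A+ and B, then for every real $\lambda>0$ and every $\Sigma\subseteq\mathbb N^m$ $$\tau(\lambda\cdot I(\Sigma))=\sum_{(v_1,\dots,v_m)\in P_\Sigma}\ \bigcap_{k=1}^m\mathfrak p_k^{(\lfloor\lambda v_k\rfloor+1-\operatorname{ht}\mathfrak p_k)}.$$ -/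

import Mathlib

namespace FConvexity

noncomputable section

/-- The symbolic power `P^(l) = P^l R_P ∩ R` of a prime ideal. For an integer exponent `l ≤ 0` one
has `P^(l) = R`, which is `symbolicPower P l.toNat`. -/
def symbolicPower {R : Type*} [CommRing R] (P : Ideal R) [P.IsPrime] (l : ℕ) : Ideal R :=
  ((P ^ l).map (algebraMap R (Localization.AtPrime P))).comap
    (algebraMap R (Localization.AtPrime P))

/-- The integral closure of an ideal `I`: all `x` satisfying an equation
`x^d + a₁ x^(d-1) + ⋯ + a_d = 0` with `d ≥ 1` and `a_i ∈ I^i`. -/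
def idealClosure {R : Type*} [CommRing R] (I : Ideal R) : Set R :=
  {x | ∃ d : ℕ, 1 ≤ d ∧ ∃ a : ℕ → R, (∀ i, a i ∈ I ^ i) ∧
    x ^ d + ∑ i ∈ Finset.Icc 1 d, a i * x ^ (d - i) = 0}

/-- The ideal `I^[q]` generated by the `q`-th powers of the elements of `I`. -/
def frobeniusPower {R : Type*} [CommRing R] (q : ℕ) (I : Ideal R) : Ideal R :=
  Ideal.span ((fun g : R => g ^ q) '' (I : Set R))

/-- `J = I^[1/q]`: `J` is the smallest ideal with `I ⊆ J^[q]`. -/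
def IsFrobeniusRoot {R : Type*} [CommRing R] (q : ℕ) (I J : Ideal R) : Prop :=
  IsLeast {J' : Ideal R | I ≤ frobeniusPower q J'} J

/-- `T = τ(c • I)`: for all `e ≫ 0`, `T` is the `p^e`-th root of `I^⌈c p^e⌉`. -/
def IsTestIdeal {R : Type*} [CommRing R] (p : ℕ) (c : ℝ) (I T : Ideal R) : Prop :=
  ∀ᶠ e : ℕ in Filter.atTop, IsFrobeniusRoot (p ^ e) (I ^ ⌈c * (p : ℝ) ^ e⌉₊) T

/-- The generalized test ideal is unique. -/
theorem IsTestIdeal.unique {R : Type*} [CommRing R] {p : ℕ} {c : ℝ} {I T T' : Ideal R}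
    (h : IsTestIdeal p c I T) (h' : IsTestIdeal p c I T') : T = T' := by
  obtain ⟨e, he, he'⟩ := (h.and h').exists
  exact IsLeast.unique he he'

section Family

variable {R : Type*} [CommRing R] {m : ℕ} (P : Fin m → Ideal R)

/-- `I^σ = P₁^σ₁ ⋯ P_m^σ_m`. -/
def prodPow (σ : Fin m → ℕ) : Ideal R := ∏ k, P k ^ σ k

/-- `I(Σ) = ∑_{σ ∈ Σ} I^σ`. -/
def sumProdPow (A : Set (Fin m → ℕ)) : Ideal R := ⨆ σ ∈ A, prodPow P σ

variable [∀ k, (P k).IsPrime]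

/-- `e_k(σ) = max {l : I^σ ⊆ P_k^(l)}`. -/
def expo (k : Fin m) (σ : Fin m → ℕ) : ℕ :=
  sSup {l : ℕ | prodPow P σ ≤ symbolicPower (P k) l}

/-- The convex hull in `ℚ^m` of the vectors `e(σ) = (e₁(σ), …, e_m(σ))`, `σ ∈ Σ`. -/
def expoPolytope (A : Set (Fin m → ℕ)) : Set (Fin m → ℚ) :=
  convexHull ℚ ((fun (σ : Fin m → ℕ) (k : Fin m) => (expo P k σ : ℚ)) '' A)

/-- Condition A: the integral closure of `I^σ` is `⋂_k P_k^(e_k(σ))`, for every `σ`. -/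
def ConditionA : Prop :=
  ∀ σ : Fin m → ℕ,
    idealClosure (prodPow P σ) = ((⨅ k, symbolicPower (P k) (expo P k σ) : Ideal R) : Set R)

/-- Condition A+: for every `Σ ⊆ ℕ^m`, the integral closure of `I(Σ)` is the sum of the ideals
`⋂_k P_k^(e_k(⌈v⌉))` over all `v` in the convex hull of `Σ` in `ℚ^m`. -/
def ConditionAPlus : Prop :=
  ∀ A : Set (Fin m → ℕ),
    idealClosure (sumProdPow P A) =
      ((⨆ v ∈ convexHull ℚ ((fun (σ : Fin m → ℕ) (k : Fin m) => (σ k : ℚ)) '' A),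
        ⨅ k, symbolicPower (P k) (expo P k (fun j => ⌈v j⌉₊)) : Ideal R) : Set R)

end Family

/-- Condition B: some polynomial `f ∈ ⋂_k P_k^(ht P_k)` has a square-free initial monomial with
respect to some term order. -/
def ConditionB {F : Type*} [Field F] {n m : ℕ} (P : Fin m → Ideal (MvPolynomial (Fin n) F))
    [∀ k, (P k).IsPrime] : Prop :=
  ∃ f : MvPolynomial (Fin n) F, f ≠ 0 ∧
    (∀ k, f ∈ symbolicPower (P k) (P k).height.toNat) ∧
    ∃ ord : MonomialOrder.{0, 0} (Fin n), ∀ i, ord.degree f i ≤ 1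

end

end FConvexity

attribute [local instance] MvPolynomial.gradedAlgebra

namespace FConvexity

open MvPolynomial Filter

universe u

/-! Let `q = p^e`. Root maps, the additive maps `c` with `c (u^q x) = u c(x)`, detect membership in
`J^[q]`, so both inclusions reduce to moving elements by root maps.

Upper bound: at a prime `P` of height `h` the localization is regular, so `P` is generated there by
`h` elements. By pigeonhole on monomials in these, a root map takes `P^(r)` into `P^(s)` once `r + q
> q s + h (q - 1)` (`IsRootMap.mem_symbolicPower`). Applied to `I^⌈λq⌉`, this gives the stated
exponents.

Lower bound: let `g` lie in an intersection on the right-hand side. For one large `q`, the element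
`g^q f^(q-1)` has such high order at every `P_k` that A or A+ puts it in the integral closure of
`I^⌈λq⌉`. Hence a fixed nonzero `d` multiplies its powers into the matching powers of `I^⌈λq⌉`. As
the initial monomial of `f` is square-free, some root map of higher level sends `d` times the
resulting power of `f` to a unit; it extracts `g`, which thus lies in every `J` with `I^⌈λq'⌉ ⊆
J^[q']` for large `q'` (`eventually_mem_of_mem_idealClosure`).

The exponents of powers are controlled because `e_k` is additive: orders at `P_k` add on products,
which is itself derived from `f` (`coeff_mem_of_eval_mem_symbolicPower`). -/

/-- A `q`-root map: an additive endomorphism `c` with `c (u ^ q * x) = u * c x`. -/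
def IsRootMap {R : Type*} [CommRing R] (q : ℕ) (c : R →+ R) : Prop :=
  ∀ u x, c (u ^ q * x) = u * c x

theorem IsRootMap.mem_of_mem_frobeniusPower {R : Type*} [CommRing R] {q : ℕ} {c : R →+ R}
    (hc : IsRootMap q c) {J : Ideal R} {x : R} (hx : x ∈ frobeniusPower q J) : c x ∈ J := by
  suffices ∀ a, c (a * x) ∈ J by simpa using this 1
  induction hx using Submodule.span_induction with
  | mem x h =>
    obtain ⟨g, hg, rfl⟩ := h
    intro a
    rw [mul_comm, hc]
    exact J.mul_mem_right _ hg
  | zero => simp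
  | add x y _ _ hx hy =>
    intro a
    rw [mul_add, map_add]
    exact J.add_mem (hx a) (hy a)
  | smul b x hx ih =>
    intro a
    rw [smul_eq_mul, ← mul_assoc]
    exact ih _

/-! ### Root maps on fields and on polynomial rings. -/

section Field

variable {F : Type u} [Field F] (p : ℕ) [Fact p.Prime] [CharP F p]

/-- The `l i` are `q`-th roots of coordinates in a basis of `F` over `F^q`. The basis may be
infinite; allowing every `t ⊇ s` lets one finite index set serve several elements. -/
theorem exists_field_rootMaps (e : ℕ) :
    ∃ (ι : Type u) (l : ι → F →+ F) (β : ι → F), (∀ i, IsRootMap (p ^ e) (l i)) ∧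
      ∀ x, ∃ s : Finset ι, ∀ t, s ⊆ t → x = ∑ i ∈ t, l i x ^ p ^ e * β i := by
  let φ := iterateFrobenius F p e
  let K := φ.fieldRange
  let B := Module.Free.chooseBasis K F
  have hinj : Function.Injective φ := φ.injective
  have hr : ∀ i x, ∃ r, φ r = (B.repr x i : F) := fun i x => (B.repr x i).2
  choose r hr using hr
  have hadd : ∀ i x y, r i (x + y) = r i x + r i y := fun i x y => hinj (by simp [hr])
  refine ⟨_, fun i => AddMonoidHom.mk' (r i) (hadd i), B, fun i u x => hinj ?_, fun x => ?_⟩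
  · have : u ^ p ^ e * x = (⟨φ u, u, rfl⟩ : K) • x := rfl
    simp only [AddMonoidHom.mk'_apply]
    rw [hr, this, map_smul, map_mul, hr]
    rfl
  · refine ⟨(B.repr x).support, fun t ht => ?_⟩
    conv_lhs => rw [← B.linearCombination_repr x, Finsupp.linearCombination_apply,
      Finsupp.sum_of_support_subset _ ht _ (by simp)]
    refine Finset.sum_congr rfl fun i _ => ?_
    have : r i x ^ p ^ e = (B.repr x i : F) := hr i x
    simp only [AddMonoidHom.mk'_apply, this]
    rfl

end Field

section Component

variable {F σ : Type*} [Field F]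

theorem scale_injective {q : ℕ} (hq : 0 < q) (b : σ →₀ ℕ) :
    Function.Injective fun a : σ →₀ ℕ => q • a + b := by
  intro a a' h
  ext i
  have := DFunLike.congr_fun (add_right_cancel h) i
  simpa [hq.ne'] using this

/-- The `q`-root map on polynomials sending the coefficient of `q a + b` through `l` to `a`. -/
noncomputable def component {q : ℕ} (hq : 0 < q) (b : σ →₀ ℕ) (l : F →+ F) :
    MvPolynomial σ F →+ MvPolynomial σ F :=
  AddMonoidHom.mk' (fun f => AddMonoidAlgebra.ofCoeff (Finsupp.mapRange l (map_zero l)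
    (Finsupp.comapDomain (fun a => q • a + b) (AddMonoidAlgebra.coeff f)
      (scale_injective hq b).injOn))) (fun f g => by
      ext a
      exact map_add l _ _)

theorem coeff_component {q : ℕ} (hq : 0 < q) (b : σ →₀ ℕ) (l : F →+ F) (f : MvPolynomial σ F)
    (a : σ →₀ ℕ) : coeff a (component hq b l f) = l (coeff (q • a + b) f) := rfl

theorem isRootMap_component {p : ℕ} [Fact p.Prime] [CharP F p] {e : ℕ} (hq : 0 < p ^ e)
    (b : σ →₀ ℕ) (hb : ∀ i, b i < p ^ e) (l : F →+ F) (hl : IsRootMap (p ^ e) l) :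
    IsRootMap (p ^ e) (component hq b l) := by
  intro u x
  induction u using MvPolynomial.induction_on' with
  | monomial t r =>
    ext a
    rw [monomial_pow, coeff_component, coeff_monomial_mul', coeff_monomial_mul']
    -- Here `b i < q` is essential: the remainder `b` cannot compensate for a missing multiple of
    -- `q`.
    have hiff : p ^ e • t ≤ p ^ e • a + b ↔ t ≤ a := by
      refine forall_congr' fun i => ?_
      simp only [Finsupp.smul_apply, Finsupp.add_apply, smul_eq_mul]
      refine ⟨fun h => ?_, fun h => le_add_right (Nat.mul_le_mul_left _ h)⟩
      by_contra! h'
      have := Nat.mul_le_mul_left (p ^ e) (Nat.succ_le_of_lt h')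
      rw [Nat.mul_succ] at this
      have := hb i
      omega
    simp only [hiff]
    split_ifs with h
    · obtain ⟨a, rfl⟩ := exists_add_of_le h
      rw [hl, coeff_component, smul_add, add_assoc, add_tsub_cancel_left, add_tsub_cancel_left]
    · exact map_zero l
  | add u v hu hv =>
    rw [add_pow_char_pow, add_mul, map_add, hu, hv, add_mul]

theorem component_monomial {q : ℕ} (hq : 0 < q) [DecidableEq σ] {s a t : σ →₀ ℕ}
    (hs : s = q • a + t) (b : σ →₀ ℕ)
    (hb : ∀ i, b i < q) (ht : ∀ i, t i < q) (l : F →+ F) (x : F) :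
    component hq b l (monomial s x) = if t = b then monomial a (l x) else 0 := by
  subst hs
  have key : ∀ a' : σ →₀ ℕ, q • a + t = q • a' + b ↔ a = a' ∧ t = b := by
    refine fun a' => ⟨fun h => ?_, fun ⟨h, h'⟩ => by rw [h, h']⟩
    have h1 : ∀ i, q * a i + t i = q * a' i + b i := fun i => DFunLike.congr_fun h i
    refine ⟨Finsupp.ext fun i => ?_, Finsupp.ext fun i => ?_⟩
    · have := congrArg (· / q) (h1 i)
      simpa [Nat.mul_add_div hq, Nat.div_eq_of_lt (hb i), Nat.div_eq_of_lt (ht i)] using this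
    · have := congrArg (· % q) (h1 i)
      simpa [Nat.mul_add_mod, Nat.mod_eq_of_lt (hb i), Nat.mod_eq_of_lt (ht i)] using this
  ext a'
  simp only [coeff_component, coeff_monomial, key]
  split_ifs with h h' h'
  · rw [h.1, coeff_monomial, if_pos rfl]
  · exact absurd h.2 h'
  · rw [coeff_monomial, if_neg fun h'' => h ⟨h'', h'⟩, map_zero]
  · rw [map_zero, coeff_zero]

theorem exists_eq_smul_add {q : ℕ} (hq : 0 < q) (s : σ →₀ ℕ) :
    ∃ a b : σ →₀ ℕ, s = q • a + b ∧ ∀ i, b i < q := by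
  refine ⟨s.mapRange (· / q) (Nat.zero_div q), s.mapRange (· % q) (Nat.zero_mod q), ?_, ?_⟩
  · ext i
    simp [Nat.div_add_mod]
  · intro i
    simpa using Nat.mod_lt _ hq

end Component

section Polynomial

variable {F : Type u} {σ : Type*} [Field F] {p : ℕ} [Fact p.Prime] [CharP F p]

/-- Reconstructs `f` from its components: `f` is a combination of `q`-th powers of images of `f`
under root maps, and these images lie in `J`. -/
theorem mem_frobeniusPower_of_forall_isRootMap (e : ℕ) {J : Ideal (MvPolynomial σ F)}
    {f : MvPolynomial σ F} (hf : ∀ c, IsRootMap (p ^ e) c → c f ∈ J) :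
    f ∈ frobeniusPower (p ^ e) J := by
  classical
  have hq : 0 < p ^ e := pow_pos (Nat.Prime.pos Fact.out) e
  obtain ⟨ι, l, β, hl, hsum⟩ := exists_field_rootMaps (F := F) p e
  choose s hs using hsum
  choose a b hab hb using fun t : σ →₀ ℕ => exists_eq_smul_add hq t
  -- `B` collects the exponent remainders mod `q`, `T` the field coordinates needed for all
  -- coefficients of `f`.
  let B := f.support.image b
  let T := f.support.biUnion fun t => s (coeff t f)
  let Ψ : MvPolynomial σ F →+ MvPolynomial σ F :=
    ∑ t ∈ B, ∑ i ∈ T, (AddMonoidHom.mulRight (monomial t (β i))).comp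
      ((iterateFrobenius (MvPolynomial σ F) p e).toAddMonoidHom.comp (component hq t (l i)))
  have hΨ : ∀ g, Ψ g = ∑ t ∈ B, ∑ i ∈ T, component hq t (l i) g ^ p ^ e * monomial t (β i) := by
    intro g
    simp [Ψ, iterateFrobenius_def]
  have hBlt : ∀ t ∈ B, ∀ i, t i < p ^ e := by
    intro t ht
    obtain ⟨t', -, rfl⟩ := Finset.mem_image.1 ht
    exact hb t'
  have hmono : ∀ t ∈ f.support, Ψ (monomial t (coeff t f)) = monomial t (coeff t f) := by
    intro t ht
    rw [hΨ, Finset.sum_eq_single (b t)]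
    · have : ∀ i, component hq (b t) (l i) (monomial t (coeff t f)) =
          monomial (a t) (l i (coeff t f)) := by
        intro i
        rw [component_monomial hq (hab t) _ (hb t) (hb t), if_pos rfl]
      simp only [this, monomial_pow, monomial_mul]
      rw [← hab t, ← map_sum, ← hs (coeff t f) T]
      exact Finset.subset_biUnion_of_mem (fun t => s (coeff t f)) ht
    · intro b' hb' hne
      refine Finset.sum_eq_zero fun i _ => ?_
      have : component hq b' (l i) (monomial t (coeff t f)) = 0 := by
        rw [component_monomial hq (hab t) _ (hBlt b' hb') (hb t), if_neg hne.symm]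
      rw [this, zero_pow hq.ne', zero_mul]
    · exact fun h => absurd (Finset.mem_image_of_mem b ht) h
  have hfix : Ψ f = f := by
    conv_lhs => rw [f.as_sum, map_sum]
    rw [Finset.sum_congr rfl hmono, ← f.as_sum]
  rw [← hfix, hΨ]
  refine Ideal.sum_mem _ fun t ht => Ideal.sum_mem _ fun i _ => Ideal.mul_mem_right _ _ ?_
  exact Ideal.subset_span ⟨_, hf _ (isRootMap_component hq t (hBlt t ht) _ (hl i)), rfl⟩

/-- Take the component at the leading exponent of `w`. An exponent `q a + deg w` with `a ≠ 0`
exceeds the leading one, so only a constant survives. -/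
theorem exists_isRootMap_isUnit (ord : MonomialOrder σ) (e : ℕ) {w : MvPolynomial σ F}
    (hw : w ≠ 0) (hdeg : ∀ i, ord.degree w i < p ^ e) :
    ∃ c : MvPolynomial σ F →+ MvPolynomial σ F, IsRootMap (p ^ e) c ∧ IsUnit (c w) := by
  classical
  have hq : 0 < p ^ e := pow_pos (Nat.Prime.pos Fact.out) e
  obtain ⟨ι, l, β, hl, hsum⟩ := exists_field_rootMaps (F := F) p e
  have hlc : ord.leadingCoeff w ≠ 0 := ord.leadingCoeff_ne_zero_iff.2 hw
  obtain ⟨i, hi⟩ : ∃ i, l i (ord.leadingCoeff w) ≠ 0 := by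
    by_contra! h
    obtain ⟨s, hs⟩ := hsum (ord.leadingCoeff w)
    refine hlc ((hs s subset_rfl).trans (Finset.sum_eq_zero fun i _ => ?_))
    rw [h, zero_pow hq.ne', zero_mul]
  refine ⟨component hq (ord.degree w) (l i), isRootMap_component hq _ hdeg _ (hl i), ?_⟩
  suffices component hq (ord.degree w) (l i) w = C (l i (ord.leadingCoeff w)) by
    rw [this]
    exact (IsUnit.mk0 _ hi).map C
  ext a
  rw [coeff_component, coeff_C]
  split_ifs with h
  · rw [← h, smul_zero, zero_add]
    rfl
  · rw [ord.coeff_eq_zero_of_lt, map_zero]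
    rw [map_add, add_comm]
    refine lt_add_of_pos_right _ (lt_of_le_of_ne (ord.bot_eq_zero ▸ bot_le) fun h0 => h ?_)
    have h1 : p ^ e • a = 0 := ord.toSyn.injective (by rw [← h0, map_zero])
    ext i
    have := DFunLike.congr_fun h1 i
    simpa [(Nat.Prime.pos (Fact.out : p.Prime)).ne', eq_comm] using this

end Polynomial

/-! ### Symbolic powers and local generators of a prime. -/

section Symbolic

variable {R : Type*} [CommRing R] (P : Ideal R) [P.IsPrime]

theorem mem_comap_map_atPrime_iff {I : Ideal R} {x : R} :
    x ∈ (I.map (algebraMap R (Localization.AtPrime P))).comap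
      (algebraMap R (Localization.AtPrime P)) ↔ ∃ u, u ∉ P ∧ u * x ∈ I := by
  rw [Ideal.mem_comap, IsLocalization.mem_map_algebraMap_iff P.primeCompl]
  constructor
  · rintro ⟨⟨a, s⟩, h⟩
    rw [← map_mul, IsLocalization.eq_iff_exists P.primeCompl] at h
    obtain ⟨c, hc⟩ := h
    refine ⟨c * s, (c * s).2, ?_⟩
    rw [mul_assoc, mul_comm (s : R), hc]
    exact I.mul_mem_left _ a.2
  · rintro ⟨u, hu, h⟩
    refine ⟨⟨⟨u * x, h⟩, ⟨u, hu⟩⟩, ?_⟩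
    rw [← map_mul, mul_comm]

variable {P}

theorem mem_symbolicPower_iff {l : ℕ} {x : R} :
    x ∈ symbolicPower P l ↔ ∃ u, u ∉ P ∧ u * x ∈ P ^ l :=
  mem_comap_map_atPrime_iff P

theorem pow_le_symbolicPower (l : ℕ) : P ^ l ≤ symbolicPower P l :=
  Ideal.le_comap_map

theorem symbolicPower_zero : symbolicPower P 0 = ⊤ := by
  rw [symbolicPower, pow_zero, Ideal.one_eq_top, Ideal.map_top, Ideal.comap_top]

theorem symbolicPower_antitone : Antitone (symbolicPower P) := fun _ _ h =>
  Ideal.comap_mono (Ideal.map_mono (Ideal.pow_le_pow_right h))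

theorem mem_symbolicPower_of_mul_mem {l : ℕ} {u x : R} (hu : u ∉ P)
    (h : u * x ∈ symbolicPower P l) : x ∈ symbolicPower P l := by
  obtain ⟨v, hv, hvx⟩ := mem_symbolicPower_iff.1 h
  exact mem_symbolicPower_iff.2 ⟨v * u, ‹P.IsPrime›.mul_notMem hv hu, by rwa [mul_assoc]⟩

theorem mul_mem_symbolicPower {a b : ℕ} {x y : R} (hx : x ∈ symbolicPower P a)
    (hy : y ∈ symbolicPower P b) : x * y ∈ symbolicPower P (a + b) := by
  obtain ⟨u, hu, hux⟩ := mem_symbolicPower_iff.1 hx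
  obtain ⟨v, hv, hvy⟩ := mem_symbolicPower_iff.1 hy
  refine mem_symbolicPower_iff.2 ⟨u * v, ‹P.IsPrime›.mul_notMem hu hv, ?_⟩
  rw [mul_mul_mul_comm, pow_add]
  exact Ideal.mul_mem_mul hux hvy

theorem pow_mem_symbolicPower {a : ℕ} {x : R} (hx : x ∈ symbolicPower P a) (n : ℕ) :
    x ^ n ∈ symbolicPower P (n * a) := by
  induction n with
  | zero => simp [symbolicPower_zero]
  | succ n ih =>
    rw [pow_succ, Nat.succ_mul]
    exact mul_mem_symbolicPower ih hx

/-- Krull's intersection theorem in the localization. -/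
theorem exists_notMem_symbolicPower [IsNoetherianRing R] [IsDomain R] {x : R} (hx : x ≠ 0) :
    ∃ l, x ∉ symbolicPower P l := by
  by_contra! h
  have hinj := IsLocalization.injective (Localization.AtPrime P) P.primeCompl_le_nonZeroDivisors
  have hmem : algebraMap R (Localization.AtPrime P) x ∈
      ⨅ i : ℕ, IsLocalRing.maximalIdeal (Localization.AtPrime P) ^ i := by
    rw [Ideal.mem_iInf]
    intro i
    have := h i
    rwa [symbolicPower, Ideal.mem_comap, Ideal.map_pow,
      Localization.AtPrime.map_eq_maximalIdeal] at this
  have := IsLocalization.isNoetherianRing P.primeCompl (Localization.AtPrime P) ‹_›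
  rw [Ideal.iInf_pow_eq_bot_of_isLocalRing _ (IsLocalRing.maximalIdeal.isMaximal _).ne_top,
    Ideal.mem_bot] at hmem
  exact hx (hinj (hmem.trans (map_zero _).symm))

end Symbolic

section Generators

variable {R : Type*} [CommRing R] (P : Ideal R) [P.IsPrime]

theorem exists_local_generators [IsRegularRing R] :
    ∃ y : Fin P.height.toNat → R, P.map (algebraMap R (Localization.AtPrime P)) =
      (Ideal.span (Set.range y)).map (algebraMap R (Localization.AtPrime P)) := by
  let A := Localization.AtPrime P
  have hreg := IsRegularLocalRing.spanFinrank_maximalIdeal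
    (self := IsRegularRing.isRegularLocalRing_localization P)
  rw [IsLocalization.AtPrime.ringKrullDim_eq_height P A] at hreg
  have hfg : (IsLocalRing.maximalIdeal A).FG := IsNoetherian.noetherian _
  have hcard : (IsLocalRing.maximalIdeal A).generators.ncard = P.height.toNat := by
    rw [Submodule.FG.generators_ncard hfg]
    have : ((IsLocalRing.maximalIdeal A).spanFinrank : ℕ∞) = P.height := by exact_mod_cast hreg
    rw [← this, ENat.toNat_natCast]
  have hfin := Submodule.FG.finite_generators hfg
  obtain ⟨z, hz⟩ : ∃ z : Fin P.height.toNat → A,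
      Set.range z = (IsLocalRing.maximalIdeal A).generators := by
    have := hfin.to_subtype
    let e := Finite.equivFinOfCardEq hcard
    exact ⟨Subtype.val ∘ e.symm, by rw [e.symm.surjective.range_comp, Subtype.range_coe]⟩
  -- Clearing a denominator changes a generator only by a unit.
  have hex : ∀ w : A, ∃ a : R, Ideal.span {algebraMap R A a} = Ideal.span {w} := by
    intro w
    obtain ⟨⟨a, s⟩, h⟩ := IsLocalization.surj P.primeCompl w
    refine ⟨a, ?_⟩
    rw [← h]
    exact Ideal.span_singleton_mul_right_unit (IsLocalization.map_units A s) w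
  choose g hg using hex
  refine ⟨fun i => g (z i), ?_⟩
  rw [Localization.AtPrime.map_eq_maximalIdeal, Ideal.map_span]
  conv_lhs => rw [← (IsLocalRing.maximalIdeal A).span_generators, ← hz]
  change Ideal.span _ = _
  have key : ∀ w : Fin P.height.toNat → A, Ideal.span (Set.range w) = ⨆ i, Ideal.span {w i} := by
    intro w
    rw [← Ideal.span_iUnion, Set.iUnion_singleton_eq_range]
  rw [← Set.range_comp, key, key]
  exact iSup_congr fun i => (hg _).symm

end Generators

/-! ### Forms in local generators, and additivity of orders. -/

section Forms

variable {R ι : Type*} [CommRing R] {P : Ideal R} [P.IsPrime] {y : ι → R}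

theorem mem_of_map_eq_map_span (hy : P.map (algebraMap R (Localization.AtPrime P)) =
      (Ideal.span (Set.range y)).map (algebraMap R (Localization.AtPrime P))) (i : ι) :
    y i ∈ P := by
  have : y i ∈ (P.map (algebraMap R (Localization.AtPrime P))).comap
      (algebraMap R (Localization.AtPrime P)) := by
    rw [hy]
    exact Ideal.le_comap_map (Ideal.subset_span ⟨i, rfl⟩)
  obtain ⟨u, hu, h⟩ := (mem_comap_map_atPrime_iff P).1 this
  exact (‹P.IsPrime›.mem_or_mem h).resolve_left hu

theorem exists_isHomogeneous_eval_eq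
    (hy : P.map (algebraMap R (Localization.AtPrime P)) =
      (Ideal.span (Set.range y)).map (algebraMap R (Localization.AtPrime P)))
    {d : ℕ} {x : R} (hx : x ∈ symbolicPower P d) :
    ∃ u, u ∉ P ∧ ∃ G : MvPolynomial ι R, G.IsHomogeneous d ∧ eval y G = u * x := by
  rw [symbolicPower, Ideal.map_pow, hy, ← Ideal.map_pow, mem_comap_map_atPrime_iff] at hx
  obtain ⟨u, hu, h⟩ := hx
  exact ⟨u, hu, (Ideal.mem_span_pow_iff_exists_isHomogeneous y _).1 h⟩

omit [P.IsPrime] in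
theorem degree_eq_of_isHomogeneous {G : MvPolynomial ι R} {d : ℕ} (hG : G.IsHomogeneous d)
    {a : ι →₀ ℕ} (ha : a ∈ G.support) : a.degree = d := by
  rw [Finsupp.degree_eq_weight_one]
  exact hG (mem_support_iff.1 ha)

theorem pow_mem_frobeniusPower {q : ℕ} {J : Ideal R} {x : R} (hx : x ∈ J) :
    x ^ q ∈ frobeniusPower q J :=
  Ideal.subset_span ⟨x, hx, rfl⟩

theorem eval_mem_of_forall_monomial {I : Ideal R} {G : MvPolynomial ι R}
    (h : ∀ a ∈ G.support, (a.prod fun i k => y i ^ k) ∈ I) : eval y G ∈ I := by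
  rw [eval_eq]
  exact I.sum_mem fun a ha => I.mul_mem_left _ (h a ha)

omit [P.IsPrime] in
theorem prod_pow_mem_pow (hy : ∀ i, y i ∈ P) (a : ι →₀ ℕ) :
    (a.prod fun i k => y i ^ k) ∈ P ^ a.degree := by
  rw [Finsupp.prod, Finsupp.degree_apply, ← Finset.prod_pow_eq_pow_sum]
  exact Ideal.prod_mem_prod fun i _ => Ideal.pow_mem_pow (hy i) _

variable [Fintype ι]

theorem degree_le_of_forall_lt {q : ℕ} {b : ι →₀ ℕ} (hb : ∀ i, b i < q) :
    b.degree ≤ Fintype.card ι * (q - 1) := by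
  rw [Finsupp.degree_eq_sum]
  simpa using Finset.sum_le_card_nsmul Finset.univ b (q - 1) fun i _ => Nat.le_sub_one_of_lt (hb i)

-- Write `a = q a' + b` with all `b i < q`. Since `b` has degree at most `h (q - 1)`, where `h` is
-- the number of generators, `a'` has degree at least `s`.
omit [P.IsPrime] in
theorem prod_pow_mem_frobeniusPower (hy : ∀ i, y i ∈ P) {q s : ℕ} (hq : 0 < q) {a : ι →₀ ℕ}
    (ha : q * s + Fintype.card ι * (q - 1) < a.degree + q) :
    (a.prod fun i k => y i ^ k) ∈ frobeniusPower q (P ^ s) := by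
  obtain ⟨a, b, rfl, hb⟩ := exists_eq_smul_add hq a
  have hdeg : s ≤ a.degree := by
    have h1 := degree_le_of_forall_lt hb
    rw [map_add, map_nsmul, smul_eq_mul] at ha
    by_contra! h
    have := Nat.mul_le_mul_left q (Nat.succ_le_of_lt h)
    rw [Nat.mul_succ] at this
    omega
  have hprod : ((q • a + b).prod fun i k => y i ^ k) =
      (a.prod fun i k => y i ^ k) ^ q * b.prod fun i k => y i ^ k := by
    rw [Finsupp.prod_add_index' (by simp) (fun i => pow_add _)]
    congr 1
    simp only [Finsupp.prod_fintype, pow_zero, implies_true, Finsupp.smul_apply, smul_eq_mul,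
      mul_comm q, pow_mul, Finset.prod_pow]
  rw [hprod]
  exact Ideal.mul_mem_right _ _ (pow_mem_frobeniusPower
    (Ideal.pow_le_pow_right hdeg (prod_pow_mem_pow hy a)))

omit [P.IsPrime] in
theorem prod_pow_mem_frobeniusPower_of_le (hy : ∀ i, y i ∈ P) {q : ℕ} {a : ι →₀ ℕ} {i : ι}
    (ha : q ≤ a i) : (a.prod fun i k => y i ^ k) ∈ frobeniusPower q P := by
  rw [Finsupp.prod_fintype _ _ (by simp)]
  refine Ideal.mem_of_dvd _ (Finset.dvd_prod_of_mem _ (Finset.mem_univ i)) ?_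
  obtain ⟨k, hk⟩ := exists_add_of_le ha
  rw [hk, pow_add]
  exact Ideal.mul_mem_right _ _ (pow_mem_frobeniusPower (hy i))

theorem IsRootMap.mem_symbolicPower
    (hy : P.map (algebraMap R (Localization.AtPrime P)) =
      (Ideal.span (Set.range y)).map (algebraMap R (Localization.AtPrime P)))
    {q r s : ℕ} (hq : 0 < q) (hr : q * s + Fintype.card ι * (q - 1) < r + q) {c : R →+ R}
    (hc : IsRootMap q c) {x : R} (hx : x ∈ symbolicPower P r) : c x ∈ symbolicPower P s := by
  obtain ⟨u, hu, G, hG, hGx⟩ := exists_isHomogeneous_eval_eq hy hx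
  have hmem : eval y G ∈ frobeniusPower q (P ^ s) := by
    refine eval_mem_of_forall_monomial fun a ha => ?_
    refine prod_pow_mem_frobeniusPower (mem_of_map_eq_map_span hy) hq ?_
    rwa [degree_eq_of_isHomogeneous hG ha]
  refine mem_symbolicPower_iff.2 ⟨u, hu, ?_⟩
  rw [← hc]
  refine hc.mem_of_mem_frobeniusPower ?_
  -- The multiplier enters as `u^q x = u^(q-1) (u x)`.
  rw [← Nat.succ_pred_eq_of_pos hq, pow_succ, mul_assoc, ← hGx, Nat.succ_pred_eq_of_pos hq]
  exact Ideal.mul_mem_left _ _ hmem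

omit [P.IsPrime] in
theorem eval_mem_frobeniusPower (hy : ∀ i, y i ∈ P) {q d : ℕ} (hq : 0 < q)
    {G : MvPolynomial ι R} (hG : G.IsHomogeneous d) (hd : Fintype.card ι * (q - 1) < d) :
    eval y G ∈ frobeniusPower q P := by
  refine eval_mem_of_forall_monomial fun a ha => ?_
  rw [← pow_one P]
  refine prod_pow_mem_frobeniusPower hy hq ?_
  rw [degree_eq_of_isHomogeneous hG ha]
  omega

/-- Up to a multiplier, `f^(q-1)` is a form of degree `h (q - 1)` in the `h` generators. Each of its
monomials is divisible by some `y_i^q` or equals `∏ y_i^(q-1)`. If `v` moved the latter into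
`P^[q]`, then `c` would put a unit times an element outside `P` into `P`. -/
theorem prod_pow_pred_notMem
    (hy : P.map (algebraMap R (Localization.AtPrime P)) =
      (Ideal.span (Set.range y)).map (algebraMap R (Localization.AtPrime P)))
    {f : R} (hf : f ∈ symbolicPower P (Fintype.card ι)) {q : ℕ} (hq : 0 < q) {c : R →+ R}
    (hc : IsRootMap q c) (hu : IsUnit (c (f ^ (q - 1)))) {v : R} (hv : v ∉ P) :
    v * ∏ i, y i ^ (q - 1) ∉ frobeniusPower q P := by
  classical
  intro hmem
  have hyP := mem_of_map_eq_map_span hy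
  obtain ⟨u, huP, G, hG, hGf⟩ := exists_isHomogeneous_eval_eq hy hf
  have hG' := hG.pow (q - 1)
  have h1 : v * (u * f) ^ (q - 1) ∈ frobeniusPower q P := by
    rw [← hGf, ← map_pow, eval_eq, Finset.mul_sum]
    refine Ideal.sum_mem _ fun a ha => ?_
    rw [mul_left_comm]
    refine Ideal.mul_mem_left _ _ ?_
    by_cases h : ∃ i, q ≤ a i
    · obtain ⟨i, hi⟩ := h
      exact Ideal.mul_mem_left _ _ (prod_pow_mem_frobeniusPower_of_le hyP hi)
    · push Not at h
      have hdeg := degree_eq_of_isHomogeneous hG' ha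
      rw [Finsupp.degree_eq_sum] at hdeg
      have hall : ∀ i ∈ Finset.univ, a i = q - 1 := by
        rw [← Finset.sum_eq_sum_iff_of_le fun i _ => Nat.le_sub_one_of_lt (h i), hdeg]
        simp
      change v * (a.prod fun i k => y i ^ k) ∈ _
      rw [Finsupp.prod_fintype _ _ (by simp), Finset.prod_congr rfl fun i hi => by rw [hall i hi]]
      exact hmem
  have h2 : (v * u) ^ q * f ^ (q - 1) ∈ frobeniusPower q P := by
    obtain ⟨k, rfl⟩ := Nat.exists_eq_succ_of_ne_zero hq.ne'
    have : (v * u) ^ (k + 1) * f ^ k = (v ^ k * u) * (v * (u * f) ^ k) := by ring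
    simp only [Nat.succ_eq_add_one, add_tsub_cancel_right] at h1 ⊢
    rw [this]
    exact Ideal.mul_mem_left _ _ h1
  have h3 := hc.mem_of_mem_frobeniusPower h2
  rw [hc] at h3
  refine ‹P.IsPrime›.mul_notMem hv huP ((‹P.IsPrime›.mem_or_mem h3).resolve_right fun h => ?_)
  exact ‹P.IsPrime›.ne_top (Ideal.eq_top_of_isUnit_mem _ h hu)

/-- The associated graded ring of `R_P` is a polynomial ring in the classes of the `y i`. -/
theorem coeff_mem_of_eval_mem_symbolicPower
    (hy : P.map (algebraMap R (Localization.AtPrime P)) =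
      (Ideal.span (Set.range y)).map (algebraMap R (Localization.AtPrime P)))
    {f : R} (hf : f ∈ symbolicPower P (Fintype.card ι)) {q : ℕ} {c : R →+ R}
    (hc : IsRootMap q c) (hu : IsUnit (c (f ^ (q - 1)))) {H : MvPolynomial ι R} {d : ℕ}
    (hH : H.IsHomogeneous d) (hd : d < q) (hmem : eval y H ∈ symbolicPower P (d + 1))
    (a : ι →₀ ℕ) : coeff a H ∈ P := by
  classical
  by_contra ha
  have hyP := mem_of_map_eq_map_span hy
  have hq : 0 < q := by omega
  have hsupp : a ∈ H.support := mem_support_iff.2 fun h => ha (h ▸ P.zero_mem)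
  have hdega := degree_eq_of_isHomogeneous hH hsupp
  have hle : ∀ i, a i ≤ q - 1 := fun i => by
    have := Finsupp.le_degree i a
    omega
  -- Multiplying by the monomial complementary to `a` turns `y^a` into `∏ y_i^(q-1)`, while any
  -- other monomial of the same degree acquires an exponent at least `q`.
  let b : ι →₀ ℕ := Finsupp.equivFunOnFinite.symm fun i => q - 1 - a i
  have hb : ∀ i, b i = q - 1 - a i := fun i => rfl
  have hdegb : a.degree + b.degree = Fintype.card ι * (q - 1) := by
    rw [Finsupp.degree_eq_sum, Finsupp.degree_eq_sum, ← Finset.sum_add_distrib,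
      Finset.sum_congr rfl fun i _ => show a i + b i = q - 1 by rw [hb]; have := hle i; omega]
    simp
  let Y : R := b.prod fun i k => y i ^ k
  have hYb : eval y (monomial b 1) = Y := by rw [eval_monomial, one_mul]
  have hYmul : ∀ t : ι →₀ ℕ, Y * (∏ i ∈ t.support, y i ^ t i) =
      (b + t).prod fun i k => y i ^ k := by
    intro t
    rw [Finsupp.prod_add_index' (by simp) (fun i => pow_add _)]
    rfl
  obtain ⟨v, hv, G, hG, hGH⟩ := exists_isHomogeneous_eval_eq hy hmem
  have h1 : v * (Y * eval y H) ∈ frobeniusPower q P := by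
    rw [mul_left_comm, ← hGH, ← hYb, ← map_mul]
    refine eval_mem_frobeniusPower hyP hq ((isHomogeneous_monomial 1 rfl).mul hG) ?_
    omega
  have h2 : Y * eval y H - coeff a H * ∏ i, y i ^ (q - 1) ∈ frobeniusPower q P := by
    rw [eval_eq, Finset.mul_sum, ← Finset.add_sum_erase _ _ hsupp]
    have hfirst : Y * (coeff a H * ∏ i ∈ a.support, y i ^ a i) =
        coeff a H * ∏ i, y i ^ (q - 1) := by
      rw [mul_left_comm, hYmul, Finsupp.prod_fintype _ _ (by simp)]
      congr 1
      refine Finset.prod_congr rfl fun i _ => ?_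
      rw [Finsupp.add_apply, hb, Nat.sub_add_cancel (hle i)]
    rw [hfirst, add_sub_cancel_left]
    refine Ideal.sum_mem _ fun t ht => ?_
    rw [mul_left_comm, hYmul]
    refine Ideal.mul_mem_left _ _ ?_
    obtain ⟨hne, ht⟩ := Finset.mem_erase.1 ht
    obtain ⟨i, hi⟩ : ∃ i, a i < t i := by
      by_contra! h
      refine hne (Finsupp.ext fun i => ?_)
      have hdegt := degree_eq_of_isHomogeneous hH ht
      rw [← hdega, Finsupp.degree_eq_sum, Finsupp.degree_eq_sum,
        Finset.sum_eq_sum_iff_of_le fun i _ => h i] at hdegt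
      exact hdegt i (Finset.mem_univ i)
    refine prod_pow_mem_frobeniusPower_of_le hyP (i := i) ?_
    rw [Finsupp.add_apply, hb]
    have := hle i
    omega
  refine prod_pow_pred_notMem hy hf hq hc hu (‹P.IsPrime›.mul_notMem hv ha) ?_
  have := Ideal.sub_mem _ h1 (Ideal.mul_mem_left _ v h2)
  rwa [mul_sub, sub_sub_cancel, ← mul_assoc] at this

/-- Elements of exact order have nonzero initial forms over `R/P`, and a polynomial ring over a
domain is a domain. -/
theorem mul_notMem_symbolicPower
    (hy : P.map (algebraMap R (Localization.AtPrime P)) =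
      (Ideal.span (Set.range y)).map (algebraMap R (Localization.AtPrime P)))
    {f : R} (hf : f ∈ symbolicPower P (Fintype.card ι)) {q : ℕ} {c : R →+ R}
    (hc : IsRootMap q c) (hu : IsUnit (c (f ^ (q - 1)))) {a b : ℕ} (hab : a + b < q) {x z : R}
    (hx : x ∈ symbolicPower P a) (hx' : x ∉ symbolicPower P (a + 1))
    (hz : z ∈ symbolicPower P b) (hz' : z ∉ symbolicPower P (b + 1)) :
    x * z ∉ symbolicPower P (a + b + 1) := by
  intro hxz
  have key : ∀ {d : ℕ} {w : R}, w ∈ symbolicPower P d → w ∉ symbolicPower P (d + 1) →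
      ∃ u, u ∉ P ∧ ∃ G : MvPolynomial ι R, G.IsHomogeneous d ∧ eval y G = u * w ∧
        G.map (Ideal.Quotient.mk P) ≠ 0 := by
    intro d w hw hw'
    obtain ⟨u, hu, G, hG, hGw⟩ := exists_isHomogeneous_eval_eq hy hw
    refine ⟨u, hu, G, hG, hGw, fun h0 => hw' (mem_symbolicPower_of_mul_mem hu ?_)⟩
    refine pow_le_symbolicPower _ ?_
    rw [← hGw, eval_eq]
    refine Ideal.sum_mem _ fun t ht => ?_
    rw [pow_succ']
    refine Ideal.mul_mem_mul ?_ ?_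
    · rw [← Ideal.Quotient.eq_zero_iff_mem, ← coeff_map, h0, coeff_zero]
    · rw [← degree_eq_of_isHomogeneous hG ht]
      exact prod_pow_mem_pow (mem_of_map_eq_map_span hy) t
  obtain ⟨u, -, G, hG, hGx, hG0⟩ := key hx hx'
  obtain ⟨v, -, K, hK, hKz, hK0⟩ := key hz hz'
  refine mul_ne_zero hG0 hK0 ?_
  rw [← map_mul]
  ext t
  rw [coeff_map, coeff_zero, Ideal.Quotient.eq_zero_iff_mem]
  refine coeff_mem_of_eval_mem_symbolicPower hy hf hc hu (hG.mul hK) hab ?_ t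
  rw [map_mul, hGx, hKz, mul_mul_mul_comm]
  exact Ideal.mul_mem_left _ _ hxz

end Forms

/-! ### Additivity of the exponents `e_k`, and convex hulls. -/

section Family

variable {R : Type*} [CommRing R] {m : ℕ} {P : Fin m → Ideal R}

theorem prodPow_add (σ τ : Fin m → ℕ) : prodPow P (σ + τ) = prodPow P σ * prodPow P τ := by
  simp only [prodPow, Pi.add_apply, pow_add, Finset.prod_mul_distrib]

theorem prodPow_zero : prodPow P 0 = 1 := by simp [prodPow]

theorem prodPow_nsmul (N : ℕ) (σ : Fin m → ℕ) : prodPow P (N • σ) = prodPow P σ ^ N := by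
  simp only [prodPow, Pi.smul_apply, smul_eq_mul, mul_comm N, pow_mul, Finset.prod_pow]

theorem prodPow_ne_bot [IsDomain R] (hne : ∀ k, P k ≠ ⊥) (σ : Fin m → ℕ) : prodPow P σ ≠ ⊥ :=
  Finset.prod_ne_zero_iff.2 fun k _ => pow_ne_zero _ (hne k)

open scoped Pointwise in
/-- The set of all sums of `N` elements of `A`. -/
def sumset (A : Set (Fin m → ℕ)) : ℕ → Set (Fin m → ℕ)
  | 0 => {0}
  | N + 1 => sumset A N + A

open scoped Pointwise in
theorem sumProdPow_add (A B : Set (Fin m → ℕ)) :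
    sumProdPow P (A + B) = sumProdPow P A * sumProdPow P B := by
  simp only [sumProdPow, Ideal.iSup_mul, Ideal.mul_iSup, ← prodPow_add]
  apply le_antisymm
  · refine iSup₂_le fun τ hτ => ?_
    obtain ⟨a, ha, b, hb, rfl⟩ := hτ
    exact le_iSup₂_of_le b hb (le_iSup₂_of_le a ha le_rfl)
  · exact iSup₂_le fun b hb => iSup₂_le fun a ha =>
      le_iSup₂_of_le (a + b) (Set.add_mem_add ha hb) le_rfl

theorem sumProdPow_sumset (A : Set (Fin m → ℕ)) (N : ℕ) :
    sumProdPow P (sumset A N) = sumProdPow P A ^ N := by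
  induction N with
  | zero => simp [sumset, sumProdPow, prodPow_zero]
  | succ N ih => rw [sumset, sumProdPow_add, ih, pow_succ]

theorem nsmul_mem_sumset {A : Set (Fin m → ℕ)} {σ : Fin m → ℕ} (hσ : σ ∈ A) (N : ℕ) :
    N • σ ∈ sumset A N := by
  induction N with
  | zero => simp [sumset]
  | succ N ih => rw [succ_nsmul]; exact Set.add_mem_add ih hσ

variable [∀ k, (P k).IsPrime]

theorem prodPow_le_symbolicPower_expo (k : Fin m) (σ : Fin m → ℕ) :
    prodPow P σ ≤ symbolicPower (P k) (expo P k σ) := by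
  by_cases h : BddAbove {l : ℕ | prodPow P σ ≤ symbolicPower (P k) l}
  · exact Nat.sSup_mem ⟨0, by simp [symbolicPower_zero]⟩ h
  -- An unbounded supremum defaults to `0`, where the symbolic power is the whole ring.
  · rw [expo, Nat.sSup_of_not_bddAbove h, symbolicPower_zero]
    exact le_top

variable [IsDomain R] [IsNoetherianRing R]

theorem not_prodPow_le_symbolicPower (hne : ∀ k, P k ≠ ⊥) (k : Fin m) (σ : Fin m → ℕ) :
    ¬ prodPow P σ ≤ symbolicPower (P k) (expo P k σ + 1) := by
  intro h
  obtain ⟨x, hx, hx0⟩ := Submodule.exists_mem_ne_zero_of_ne_bot (prodPow_ne_bot hne σ)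
  obtain ⟨l, hl⟩ := exists_notMem_symbolicPower (P := P k) hx0
  have hb : BddAbove {l : ℕ | prodPow P σ ≤ symbolicPower (P k) l} := by
    refine ⟨l, fun l' hl' => ?_⟩
    by_contra! hlt
    exact hl (symbolicPower_antitone hlt.le (hl' hx))
  have := le_csSup hb h
  rw [← expo] at this
  omega

omit [IsDomain R] [IsNoetherianRing R] in
theorem expo_eq_of_le_of_not_le {k : Fin m} {σ : Fin m → ℕ} {l : ℕ}
    (h : prodPow P σ ≤ symbolicPower (P k) l) (h' : ¬ prodPow P σ ≤ symbolicPower (P k) (l + 1)) :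
    expo P k σ = l := by
  have hub : l ∈ upperBounds {l : ℕ | prodPow P σ ≤ symbolicPower (P k) l} := by
    intro l' hl'
    by_contra! hlt
    exact h' (hl'.trans (symbolicPower_antitone hlt))
  exact (IsGreatest.csSup_eq ⟨h, hub⟩)

variable (P) in
/-- Orders at the primes `P k` are additive on products. -/
def OrderAdditive : Prop :=
  ∀ (k : Fin m) (a b : ℕ) (x z : R), x ∈ symbolicPower (P k) a → x ∉ symbolicPower (P k) (a + 1) →
    z ∈ symbolicPower (P k) b → z ∉ symbolicPower (P k) (b + 1) →
    x * z ∉ symbolicPower (P k) (a + b + 1)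

theorem OrderAdditive.expo_add (hP : OrderAdditive P) (hne : ∀ k, P k ≠ ⊥) (k : Fin m)
    (σ τ : Fin m → ℕ) : expo P k (σ + τ) = expo P k σ + expo P k τ := by
  apply expo_eq_of_le_of_not_le
  · rw [prodPow_add, Ideal.mul_le]
    exact fun x hx z hz => mul_mem_symbolicPower (prodPow_le_symbolicPower_expo k σ hx)
      (prodPow_le_symbolicPower_expo k τ hz)
  · intro h
    obtain ⟨x, hx, hx'⟩ := SetLike.not_le_iff_exists.1 (not_prodPow_le_symbolicPower hne k σ)
    obtain ⟨z, hz, hz'⟩ := SetLike.not_le_iff_exists.1 (not_prodPow_le_symbolicPower hne k τ)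
    rw [prodPow_add] at h
    exact hP k _ _ x z (prodPow_le_symbolicPower_expo k σ hx) hx'
      (prodPow_le_symbolicPower_expo k τ hz) hz' (h (Ideal.mul_mem_mul hx hz))

/-- The exponents `e_k` as an additive map. -/
noncomputable def OrderAdditive.expoHom (hP : OrderAdditive P) (hne : ∀ k, P k ≠ ⊥) (k : Fin m) :
    (Fin m → ℕ) →+ ℕ where
  toFun := expo P k
  map_zero' := by
    have := hP.expo_add hne k 0 0
    rw [add_zero] at this
    omega
  map_add' := hP.expo_add hne k

theorem OrderAdditive.expo_nsmul (hP : OrderAdditive P) (hne : ∀ k, P k ≠ ⊥) (k : Fin m)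
    (N : ℕ) (σ : Fin m → ℕ) : expo P k (N • σ) = N * expo P k σ :=
  map_nsmul (hP.expoHom hne k) N σ

theorem OrderAdditive.expo_eq_sum (hP : OrderAdditive P) (hne : ∀ k, P k ≠ ⊥) (k : Fin m)
    (σ : Fin m → ℕ) : expo P k σ = ∑ j, σ j * expo P k (Pi.single j 1) := by
  conv_lhs => rw [pi_eq_sum_univ' σ]
  change hP.expoHom hne k _ = _
  rw [map_sum]
  refine Finset.sum_congr rfl fun j _ => ?_
  rw [map_nsmul, smul_eq_mul]
  rfl

/-- The `ℚ`-linear extension of the exponent vector `e`. -/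
noncomputable def expoLinear (P : Fin m → Ideal R) [∀ k, (P k).IsPrime] :
    (Fin m → ℚ) →ₗ[ℚ] (Fin m → ℚ) :=
  LinearMap.pi fun k => ∑ j, (expo P k (Pi.single j 1) : ℚ) • LinearMap.proj j

omit [IsDomain R] [IsNoetherianRing R] in
theorem expoLinear_apply (s : Fin m → ℚ) (k : Fin m) :
    expoLinear P s k = ∑ j, (expo P k (Pi.single j 1) : ℚ) * s j := by
  simp [expoLinear, LinearMap.sum_apply]

theorem OrderAdditive.expoLinear_natCast (hP : OrderAdditive P) (hne : ∀ k, P k ≠ ⊥)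
    (σ : Fin m → ℕ) : expoLinear P (fun j => (σ j : ℚ)) = fun k => (expo P k σ : ℚ) := by
  ext k
  rw [expoLinear_apply, hP.expo_eq_sum hne]
  push_cast
  exact Finset.sum_congr rfl fun j _ => mul_comm _ _

theorem OrderAdditive.exists_of_mem_expoPolytope (hP : OrderAdditive P) (hne : ∀ k, P k ≠ ⊥)
    {A : Set (Fin m → ℕ)} {v : Fin m → ℚ} (hv : v ∈ expoPolytope P A) :
    ∃ s ∈ convexHull ℚ ((fun (σ : Fin m → ℕ) (k : Fin m) => (σ k : ℚ)) '' A),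
      expoLinear P s = v := by
  have : expoPolytope P A = expoLinear P ''
      convexHull ℚ ((fun (σ : Fin m → ℕ) (k : Fin m) => (σ k : ℚ)) '' A) := by
    rw [LinearMap.image_convexHull, Set.image_image]
    simp only [hP.expoLinear_natCast hne]
    rfl
  rwa [this] at hv

/-- The point `v` is the average of the exponent vectors of the `N + 1` summands. -/
theorem OrderAdditive.exists_expo_eq_of_mem_sumset (hP : OrderAdditive P) (hne : ∀ k, P k ≠ ⊥)
    {A : Set (Fin m → ℕ)} (N : ℕ) {τ : Fin m → ℕ} (hτ : τ ∈ sumset A (N + 1)) :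
    ∃ v ∈ expoPolytope P A, ∀ k, (expo P k τ : ℚ) = (N + 1) * v k := by
  induction N generalizing τ with
  | zero =>
    simp only [sumset, Set.singleton_add, zero_add, Set.image_id'] at hτ
    exact ⟨_, subset_convexHull ℚ _ ⟨τ, hτ, rfl⟩, fun k => by simp⟩
  | succ N ih =>
    rw [sumset] at hτ
    obtain ⟨τ, hτ, σ, hσ, rfl⟩ := hτ
    obtain ⟨v, hv, hvk⟩ := ih hτ
    have hN : (N : ℚ) + 2 ≠ 0 := by positivity
    refine ⟨((N + 1) / (N + 2) : ℚ) • v + (1 / (N + 2) : ℚ) • fun k => (expo P k σ : ℚ),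
      convex_convexHull ℚ _ hv (subset_convexHull ℚ _ ⟨σ, hσ, rfl⟩) (by positivity)
        (by positivity) (by field_simp; ring), fun k => ?_⟩
    rw [show (fun x1 x2 : Fin m → ℕ => x1 + x2) τ σ = τ + σ from rfl, hP.expo_add hne]
    push_cast
    rw [hvk]
    simp only [Pi.add_apply, Pi.smul_apply, smul_eq_mul]
    field_simp
    ring

omit [∀ k, (P k).IsPrime] [IsDomain R] [IsNoetherianRing R] in
theorem smul_mem_convexHull_sumset {A : Set (Fin m → ℕ)} {s : Fin m → ℚ}
    (hs : s ∈ convexHull ℚ ((fun (σ : Fin m → ℕ) (k : Fin m) => (σ k : ℚ)) '' A)) (N : ℕ) :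
    (N : ℚ) • s ∈
      convexHull ℚ ((fun (σ : Fin m → ℕ) (k : Fin m) => (σ k : ℚ)) '' sumset A N) := by
  have h : (N : ℚ) • s ∈ (LinearMap.lsmul ℚ (Fin m → ℚ) (N : ℚ)) ''
      convexHull ℚ ((fun (σ : Fin m → ℕ) (k : Fin m) => (σ k : ℚ)) '' A) := ⟨s, hs, rfl⟩
  rw [LinearMap.image_convexHull] at h
  refine convexHull_mono ?_ h
  rintro _ ⟨_, ⟨σ, hσ, rfl⟩, rfl⟩
  refine ⟨N • σ, nsmul_mem_sumset hσ N, ?_⟩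
  ext k
  simp

theorem nonneg_of_mem_convexHull {A : Set (Fin m → ℕ)} {s : Fin m → ℚ}
    (hs : s ∈ convexHull ℚ ((fun (σ : Fin m → ℕ) (k : Fin m) => (σ k : ℚ)) '' A)) : 0 ≤ s := by
  refine convexHull_min ?_ (convex_Ici (0 : Fin m → ℚ)) hs
  rintro _ ⟨σ, -, rfl⟩ k
  exact Nat.cast_nonneg _

/-- Rounding up costs a bound independent of `s`, hence negligible after scaling. -/
theorem OrderAdditive.expo_ceil_le (hP : OrderAdditive P) (hne : ∀ k, P k ≠ ⊥) {s : Fin m → ℚ}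
    (hs : 0 ≤ s) (k : Fin m) :
    (expo P k (fun j => ⌈s j⌉₊) : ℚ) ≤ expoLinear P s k + ∑ j, (expo P k (Pi.single j 1) : ℚ) := by
  rw [expoLinear_apply, hP.expo_eq_sum hne, ← Finset.sum_add_distrib]
  push_cast
  refine Finset.sum_le_sum fun j _ => ?_
  have := mul_le_mul_of_nonneg_left (Nat.ceil_lt_add_one (hs j)).le
    (Nat.cast_nonneg (α := ℚ) (expo P k (Pi.single j 1)))
  linarith

end Family

/-! ### Integral closure and numerical estimates. -/

section Closure

variable {R : Type*} [CommRing R]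

/-- `D` is the degree of an integral equation for `z`: exponents `t < D` are absorbed by `x ∈ I^D`,
and larger ones are lowered by the equation. -/
theorem exists_mul_pow_mem_of_mem_idealClosure {I : Ideal R} {z : R} (hz : z ∈ idealClosure I) :
    ∃ D, ∀ x ∈ I ^ D, ∀ t, x * z ^ t ∈ I ^ t := by
  obtain ⟨D, -, a, ha, heq⟩ := hz
  refine ⟨D, fun x hx t => ?_⟩
  induction t using Nat.strong_induction_on with
  | _ t ih =>
    rcases lt_or_ge t D with h | h
    · exact Ideal.mul_mem_right _ _ (Ideal.pow_le_pow_right h.le hx)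
    · have : x * z ^ t = -∑ i ∈ Finset.Icc 1 D, a i * (x * z ^ (t - i)) := by
        rw [← Nat.sub_add_cancel h, pow_add, eq_neg_of_add_eq_zero_left heq, mul_neg, mul_neg,
          Finset.mul_sum, Finset.mul_sum, neg_inj]
        refine Finset.sum_congr rfl fun i hi => ?_
        rw [Nat.add_sub_assoc (Finset.mem_Icc.1 hi).2, pow_add]
        ring
      rw [this]
      refine Ideal.neg_mem_iff _ |>.2 (Ideal.sum_mem _ fun i hi => ?_)
      obtain ⟨h1, h2⟩ := Finset.mem_Icc.1 hi
      have := Ideal.mul_mem_mul (ha i) (ih (t - i) (by omega))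
      rwa [← pow_add, Nat.add_sub_cancel' (h2.trans h)] at this

end Closure

section Numeric

/-- The gap `⌊c v⌋ + 1 - c v` is strictly positive, so `q` times it eventually beats the bounded
error `h + v + C`. -/
theorem eventually_le_of_le_ceil_mul {c v : ℝ} (hc : 0 < c) (hv : 0 ≤ v) (C : ℝ) (h : ℕ) :
    ∀ᶠ q : ℕ in atTop, ∀ E : ℕ, (E : ℝ) ≤ ⌈c * q⌉₊ * v + C →
      E ≤ q * (⌊c * v⌋ + 1 - (h : ℤ)).toNat + (q - 1) * h := by
  have hδ : 0 < ⌊c * v⌋ + 1 - c * v := sub_pos.2 (Int.lt_floor_add_one _)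
  have htend := (tendsto_natCast_atTop_atTop (R := ℝ)).atTop_mul_const hδ
  filter_upwards [htend.eventually_ge_atTop (h + v + C), eventually_ge_atTop 1] with q hq h1 E hE
  have hceil : (⌈c * q⌉₊ : ℝ) * v ≤ (c * q + 1) * v :=
    mul_le_mul_of_nonneg_right (Nat.ceil_lt_add_one (by positivity)).le hv
  have hr : ((⌊c * v⌋ + 1 - h : ℤ) : ℝ) ≤ ((⌊c * v⌋ + 1 - (h : ℤ)).toNat : ℝ) := by
    exact_mod_cast Int.self_le_toNat _
  push_cast at hr
  have hr' := mul_le_mul_of_nonneg_left hr (Nat.cast_nonneg (α := ℝ) q)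
  have : (E : ℝ) ≤ (q * (⌊c * v⌋ + 1 - (h : ℤ)).toNat + (q - 1) * h : ℝ) := by linarith
  rw [← Nat.cast_pred h1] at this
  exact_mod_cast this

theorem mul_toNat_add_lt {c v : ℝ} (hv : 0 ≤ v) {h q r : ℕ} (hh : 0 < h) (hq : 0 < q)
    (hr : ⌈c * q⌉₊ * v ≤ r) (hs : 0 < (⌊c * v⌋ + 1 - (h : ℤ)).toNat) :
    q * (⌊c * v⌋ + 1 - (h : ℤ)).toNat + h * (q - 1) < r + q := by
  have h1 : (⌊c * v⌋ : ℝ) * q ≤ r := by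
    calc (⌊c * v⌋ : ℝ) * q ≤ c * v * q :=
          mul_le_mul_of_nonneg_right (Int.floor_le _) (Nat.cast_nonneg q)
      _ = c * q * v := by ring
      _ ≤ ⌈c * q⌉₊ * v := mul_le_mul_of_nonneg_right (Nat.le_ceil _) hv
      _ ≤ r := hr
  have h2 : ⌊c * v⌋ * q ≤ r := by exact_mod_cast h1
  zify
  rw [Int.toNat_of_nonneg (by omega)]
  rw [Nat.cast_sub hq]
  push_cast
  nlinarith

end Numeric

/-! ### The two inclusions and the test ideal formulas. -/

section TestIdeal

variable {F : Type*} [Field F] {p : ℕ} [Fact p.Prime] [CharP F p] {n m : ℕ}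
  {P : Fin m → Ideal (MvPolynomial (Fin n) F)} [∀ k, (P k).IsPrime]

theorem ConditionB.orderAdditive (p : ℕ) [Fact p.Prime] [CharP F p] (hB : ConditionB P) :
    OrderAdditive P := by
  obtain ⟨f, hf0, hf, ord, hdeg⟩ := hB
  intro k a b x z hx hx' hz hz'
  obtain ⟨y, hy⟩ := exists_local_generators (P k)
  have hp : 1 < p := Nat.Prime.one_lt Fact.out
  -- Any power of `p` above `a + b` would serve as `q`.
  have hq : a + b < p ^ (a + b) := Nat.lt_pow_self hp
  obtain ⟨c, hc, hu⟩ := exists_isRootMap_isUnit (p := p) ord (a + b)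
    (pow_ne_zero (p ^ (a + b) - 1) hf0) (fun i => by
      rw [ord.degree_pow, Finsupp.smul_apply, smul_eq_mul]
      have := Nat.mul_le_mul_left (p ^ (a + b) - 1) (hdeg i)
      omega)
  exact mul_notMem_symbolicPower hy (by simpa using hf k) hc hu hq hx hx' hz hz'

omit [CharP F p] in
theorem IsRootMap.mem_symbolicPower_floor {c : ℝ} {e : ℕ} {k : Fin m} (hk : P k ≠ ⊥) {v : ℝ}
    (hv : 0 ≤ v) {r : ℕ} (hr : ⌈c * (p : ℝ) ^ e⌉₊ * v ≤ r)
    {x : MvPolynomial (Fin n) F} (hx : x ∈ symbolicPower (P k) r)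
    {φ : MvPolynomial (Fin n) F →+ MvPolynomial (Fin n) F} (hφ : IsRootMap (p ^ e) φ) :
    φ x ∈ symbolicPower (P k) (⌊c * v⌋ + 1 - ((P k).height.toNat : ℤ)).toNat := by
  rcases Nat.eq_zero_or_pos (⌊c * v⌋ + 1 - ((P k).height.toNat : ℤ)).toNat with h0 | hpos
  · rw [h0, symbolicPower_zero]
    trivial
  obtain ⟨y, hy⟩ := exists_local_generators (P k)
  have hq : 0 < p ^ e := pow_pos (Nat.Prime.pos Fact.out) e
  refine hφ.mem_symbolicPower hy hq ?_ hx
  rw [Fintype.card_fin]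
  -- Positive height, which comes from `P k ≠ ⊥`, makes the inequality strict.
  refine mul_toNat_add_lt hv (Nat.pos_of_ne_zero fun h => ?_) hq (by push_cast; exact hr) hpos
  rcases ENat.toNat_eq_zero.1 h with h | h
  · exact hk (Ideal.height_eq_zero_iff_eq_bot.1 h)
  · exact Ideal.height_ne_top_of_isPrime h

/-- The threshold for `e'` does not depend on `J`, as minimality of the Frobenius root requires. -/
theorem eventually_mem_of_mem_idealClosure {f : MvPolynomial (Fin n) F} (hf0 : f ≠ 0)
    {ord : MonomialOrder (Fin n)} (hdeg : ∀ i, ord.degree f i ≤ 1)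
    {I : Ideal (MvPolynomial (Fin n) F)} (hI : I ≠ ⊥) {c : ℝ} {e M : ℕ}
    (hM : c * (p : ℝ) ^ e ≤ M) {g : MvPolynomial (Fin n) F}
    (hg : g ^ p ^ e * f ^ (p ^ e - 1) ∈ idealClosure (I ^ M)) :
    ∀ᶠ e' : ℕ in atTop, ∀ J : Ideal (MvPolynomial (Fin n) F),
      I ^ ⌈c * (p : ℝ) ^ e'⌉₊ ≤ frobeniusPower (p ^ e') J → g ∈ J := by
  have hp : 1 < p := Nat.Prime.one_lt Fact.out
  have hq : 0 < p ^ e := pow_pos (Nat.Prime.pos Fact.out) e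
  obtain ⟨D, hD⟩ := exists_mul_pow_mem_of_mem_idealClosure hg
  obtain ⟨d, hd, hd0⟩ := Submodule.exists_mem_ne_zero_of_ne_bot
    (pow_ne_zero D (pow_ne_zero M hI) : (I ^ M) ^ D ≠ ⊥)
  -- This makes `deg d < p^t`, so that in each variable `deg d + (p^e - 1) p^t < p^(e+t)`.
  filter_upwards [eventually_ge_atTop (e + (ord.degree d).degree)] with e' he' J hJ
  obtain ⟨t, rfl⟩ := exists_add_of_le (le_of_add_le_left he')
  have ht : (ord.degree d).degree < p ^ t :=
    lt_of_le_of_lt (by omega) (Nat.lt_pow_self hp)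
  obtain ⟨φ, hφ, hu⟩ := exists_isRootMap_isUnit (p := p) ord (e + t)
    (mul_ne_zero hd0 (pow_ne_zero ((p ^ e - 1) * p ^ t) hf0)) (fun i => by
      rw [ord.degree_mul hd0 (pow_ne_zero _ hf0), ord.degree_pow, Finsupp.add_apply,
        Finsupp.smul_apply, smul_eq_mul]
      have h1 := Nat.mul_le_mul_left ((p ^ e - 1) * p ^ t) (hdeg i)
      have h2 := Finsupp.le_degree i (ord.degree d)
      have h3 : (p ^ e - 1) * p ^ t + p ^ t = p ^ (e + t) := by
        rw [← Nat.succ_mul, Nat.succ_eq_add_one, Nat.sub_add_cancel hq, pow_add]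
      omega)
  have hmem := hD d hd (p ^ t)
  have heq : d * (g ^ p ^ e * f ^ (p ^ e - 1)) ^ p ^ t =
      g ^ p ^ (e + t) * (d * f ^ ((p ^ e - 1) * p ^ t)) := by
    rw [mul_pow, ← pow_mul, ← pow_mul, ← pow_add]
    ring
  have hle : ⌈c * (p : ℝ) ^ (e + t)⌉₊ ≤ M * p ^ t := by
    rw [Nat.ceil_le, pow_add, ← mul_assoc]
    push_cast
    exact mul_le_mul_of_nonneg_right hM (by positivity)
  rw [heq, ← pow_mul] at hmem
  have := hφ.mem_of_mem_frobeniusPower (hJ (Ideal.pow_le_pow_right hle hmem))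
  rw [hφ] at this
  exact (Ideal.mul_unit_mem_iff_mem J hu).1 this

theorem eventually_mem_of_mem_iInf_symbolicPower (hB : ConditionB P)
    {I : Ideal (MvPolynomial (Fin n) F)} (hI : I ≠ ⊥) {c : ℝ} (hc : 0 < c) {v : Fin m → ℝ}
    (hv : ∀ k, 0 ≤ v k) {C : Fin m → ℝ}
    (h : ∀ M : ℕ, ∃ E : Fin m → ℕ, (∀ k, (E k : ℝ) ≤ M * v k + C k) ∧
      ∀ z, (∀ k, z ∈ symbolicPower (P k) (E k)) → z ∈ idealClosure (I ^ M))
    {g : MvPolynomial (Fin n) F} (hg : g ∈ ⨅ k, symbolicPower (P k)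
      (⌊c * v k⌋ + 1 - ((P k).height.toNat : ℤ)).toNat) :
    ∀ᶠ e : ℕ in atTop, ∀ J : Ideal (MvPolynomial (Fin n) F),
      I ^ ⌈c * (p : ℝ) ^ e⌉₊ ≤ frobeniusPower (p ^ e) J → g ∈ J := by
  obtain ⟨f, hf0, hf, ord, hdeg⟩ := hB
  have hp : 1 < p := Nat.Prime.one_lt Fact.out
  have hev := (tendsto_pow_atTop_atTop_of_one_lt hp).eventually (eventually_all.2 fun k =>
    eventually_le_of_le_ceil_mul hc (hv k) (C k) (P k).height.toNat)
  obtain ⟨e, he⟩ := hev.exists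
  obtain ⟨E, hE, hz⟩ := h ⌈c * (p : ℝ) ^ e⌉₊
  refine eventually_mem_of_mem_idealClosure hf0 hdeg hI (Nat.le_ceil _) (hz _ fun k => ?_)
  refine symbolicPower_antitone (he k (E k) (by push_cast; exact hE k))
    (mul_mem_symbolicPower (pow_mem_symbolicPower ?_ _) (pow_mem_symbolicPower (hf k) _))
  exact (Submodule.mem_iInf _).1 hg k

omit [Fact p.Prime] [CharP F p] in
theorem isTestIdeal_of_forall {c : ℝ} {I T : Ideal (MvPolynomial (Fin n) F)}
    (hle : ∀ e : ℕ, I ^ ⌈c * (p : ℝ) ^ e⌉₊ ≤ frobeniusPower (p ^ e) T)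
    {s : Set (MvPolynomial (Fin n) F)} (hs : T ≤ Ideal.span s)
    (hT : ∀ g ∈ s, ∀ᶠ e : ℕ in atTop, ∀ J : Ideal (MvPolynomial (Fin n) F),
      I ^ ⌈c * (p : ℝ) ^ e⌉₊ ≤ frobeniusPower (p ^ e) J → g ∈ J) :
    IsTestIdeal p c I T := by
  have hall : ∀ g ∈ T, ∀ᶠ e : ℕ in atTop, ∀ J : Ideal (MvPolynomial (Fin n) F),
      I ^ ⌈c * (p : ℝ) ^ e⌉₊ ≤ frobeniusPower (p ^ e) J → g ∈ J := by
    intro g hg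
    replace hg := hs hg
    induction hg using Submodule.span_induction with
    | mem x hx => exact hT x hx
    | zero => simp
    | add x y _ _ hx hy =>
      filter_upwards [hx, hy] with e h h' J hJ using J.add_mem (h J hJ) (h' J hJ)
    | smul a x _ hx => filter_upwards [hx] with e h J hJ using J.mul_mem_left a (h J hJ)
  -- Finitely many generators give one threshold for all of `T`.
  obtain ⟨G, hG⟩ := (isNoetherianRing_iff_ideal_fg _).1 inferInstance T
  have hfin := (Finset.eventually_all G).2 fun g hg => hall g (hG ▸ Ideal.subset_span hg)
  filter_upwards [hfin] with e he
  refine ⟨hle e, fun J hJ => ?_⟩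
  rw [← hG, Ideal.span_le]
  exact fun g hg => he g hg J hJ

theorem ConditionA.isTestIdeal_prodPow (hne : ∀ k, P k ≠ ⊥) (hA : ConditionA P)
    (hB : ConditionB P) {c : ℝ} (hc : 0 < c) (σ : Fin m → ℕ) :
    IsTestIdeal p c (prodPow P σ) (⨅ k, symbolicPower (P k)
      (⌊c * (expo P k σ : ℝ)⌋ + 1 - ((P k).height.toNat : ℤ)).toNat) := by
  have hP := hB.orderAdditive p
  refine isTestIdeal_of_forall (fun e x hx => ?_) Ideal.subset_span fun g hg => ?_
  · refine mem_frobeniusPower_of_forall_isRootMap e fun φ hφ => (Submodule.mem_iInf _).2 fun k => ?_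
    rw [← prodPow_nsmul] at hx
    refine IsRootMap.mem_symbolicPower_floor (hne k) (Nat.cast_nonneg _) ?_
      (prodPow_le_symbolicPower_expo k _ hx) hφ
    rw [hP.expo_nsmul hne]
    push_cast
    exact le_rfl
  · refine eventually_mem_of_mem_iInf_symbolicPower hB (prodPow_ne_bot hne σ) hc
      (fun k => Nat.cast_nonneg _) (C := 0) (fun M => ⟨fun k => M * expo P k σ, fun k => ?_,
        fun z hz => ?_⟩) hg
    · simp
    · rw [← prodPow_nsmul, hA, SetLike.mem_coe, Submodule.mem_iInf]
      intro k
      rw [hP.expo_nsmul hne]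
      exact hz k

theorem ConditionAPlus.isTestIdeal_sumProdPow (hne : ∀ k, P k ≠ ⊥) (hA : ConditionAPlus P)
    (hB : ConditionB P) {c : ℝ} (hc : 0 < c) (A : Set (Fin m → ℕ)) :
    IsTestIdeal p c (sumProdPow P A) (⨆ v ∈ expoPolytope P A, ⨅ k, symbolicPower (P k)
      (⌊c * ((v k : ℚ) : ℝ)⌋ + 1 - ((P k).height.toNat : ℤ)).toNat) := by
  have hP := hB.orderAdditive p
  have hnonneg : ∀ v ∈ expoPolytope P A, ∀ k, (0 : ℝ) ≤ (v k : ℚ) := by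
    intro v hv k
    have : 0 ≤ v := by
      refine convexHull_min ?_ (convex_Ici (0 : Fin m → ℚ)) hv
      rintro _ ⟨σ, -, rfl⟩ k
      exact Nat.cast_nonneg _
    exact_mod_cast this k
  refine isTestIdeal_of_forall (s := ⋃ v ∈ expoPolytope P A, ((⨅ k, symbolicPower (P k)
      (⌊c * ((v k : ℚ) : ℝ)⌋ + 1 - ((P k).height.toNat : ℤ)).toNat : Ideal _) : Set _))
    (fun e => ?_) ?_ fun g hg => ?_
  -- The average defining `v` needs at least one summand; `sumset A 0` is `{0}` even for empty `A`.
  · have hN : 0 < ⌈c * (p : ℝ) ^ e⌉₊ :=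
      Nat.ceil_pos.2 (mul_pos hc (pow_pos (Nat.cast_pos.2 (Nat.Prime.pos Fact.out)) e))
    obtain ⟨N, hN⟩ := Nat.exists_eq_succ_of_ne_zero hN.ne'
    rw [hN, ← sumProdPow_sumset]
    refine iSup₂_le fun τ hτ x hx => ?_
    obtain ⟨v, hv, hvτ⟩ := hP.exists_expo_eq_of_mem_sumset hne N hτ
    refine mem_frobeniusPower_of_forall_isRootMap e fun φ hφ => ?_
    refine (le_iSup₂_of_le v hv le_rfl : _ ≤ (⨆ v ∈ expoPolytope P A, _ : Ideal _))
      ((Submodule.mem_iInf _).2 fun k => ?_)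
    refine IsRootMap.mem_symbolicPower_floor (hne k) (hnonneg v hv k) ?_
      (prodPow_le_symbolicPower_expo k _ hx) hφ
    rw [hN]
    refine le_of_eq ?_
    have := congrArg (Rat.cast (K := ℝ)) (hvτ k)
    push_cast at this ⊢
    exact this.symm
  · exact iSup₂_le fun v hv x hx => Ideal.subset_span (Set.mem_iUnion₂.2 ⟨v, hv, hx⟩)
  · obtain ⟨v, hv, hg⟩ := Set.mem_iUnion₂.1 hg
    obtain ⟨s, hs, rfl⟩ := hP.exists_of_mem_expoPolytope hne hv
    have hI : sumProdPow P A ≠ ⊥ := by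
      obtain ⟨_, σ, hσ, -⟩ := convexHull_nonempty_iff.1 ⟨_, hv⟩
      exact ne_bot_of_le_ne_bot (prodPow_ne_bot hne σ) (le_iSup₂_of_le σ hσ le_rfl)
    refine eventually_mem_of_mem_iInf_symbolicPower hB hI hc (hnonneg _ hv)
      (C := fun k => ∑ j, (expo P k (Pi.single j 1) : ℝ))
      -- A+ is applied to the `M`-fold sumset at the point `M s` of its hull.
      (fun M => ⟨fun k => expo P k fun j => ⌈((M : ℚ) • s) j⌉₊, fun k => ?_, fun z hz => ?_⟩) hg
    · have hMs : 0 ≤ (M : ℚ) • s := smul_nonneg (Nat.cast_nonneg _) (nonneg_of_mem_convexHull hs)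
      have := hP.expo_ceil_le hne hMs k
      rw [map_smul, Pi.smul_apply, smul_eq_mul] at this
      exact_mod_cast this
    · rw [← sumProdPow_sumset, hA]
      exact (le_iSup₂_of_le _ (smul_mem_convexHull_sumset hs M) le_rfl :
        _ ≤ (⨆ v ∈ convexHull ℚ ((fun (σ : Fin m → ℕ) (k : Fin m) => (σ k : ℚ)) '' sumset A M),
          _ : Ideal _)) ((Submodule.mem_iInf _).2 hz)

end TestIdeal

end FConvexity

theorem mainTheorem1 {F : Type*} [Field F] (p : ℕ) [Fact p.Prime] [CharP F p]
    {n m : ℕ} (hm : 0 < m) (P : Fin m → Ideal (MvPolynomial (Fin n) F))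
    [∀ k, (P k).IsPrime]
    (hhom : ∀ k, (P k).IsHomogeneous (MvPolynomial.homogeneousSubmodule (Fin n) F))
    (hne : ∀ k, P k ≠ ⊥) :
    (FConvexity.ConditionA P → FConvexity.ConditionB P →
      ∀ c : ℝ, 0 < c → ∀ σ : Fin m → ℕ,
        FConvexity.IsTestIdeal p c (FConvexity.prodPow P σ)
          (⨅ k, FConvexity.symbolicPower (P k)
            (⌊c * (FConvexity.expo P k σ : ℝ)⌋ + 1 - ((P k).height.toNat : ℤ)).toNat)) ∧
    (FConvexity.ConditionAPlus P → FConvexity.ConditionB P →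
      ∀ c : ℝ, 0 < c → ∀ A : Set (Fin m → ℕ),
        FConvexity.IsTestIdeal p c (FConvexity.sumProdPow P A)
          (⨆ v ∈ FConvexity.expoPolytope P A, ⨅ k, FConvexity.symbolicPower (P k)
            (⌊c * ((v k : ℚ) : ℝ)⌋ + 1 - ((P k).height.toNat : ℤ)).toNat)) :=
  ⟨fun hA hB _ hc σ => hA.isTestIdeal_prodPow hne hB hc σ,
    fun hA hB _ hc A => hA.isTestIdeal_sumProdPow hne hB hc A⟩
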